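/- Consider $n_\ell$ leaders and $n_f$ followers in $\mathbb{R}^d$, with agents $\mathcal V=\mathcal V_\ell\sqcup\mathcal V_f$, a fixed directed edge set $\mathcal E\subset\mathcal V\times\mathcal V$ in which the edges between followers are bidirectional, neighbour sets $\mathcal N_i=\{j:(i,j)\in\mathcal E\}$, and constant desired bearings $g_{ij}^*\in\mathbb{R}^d$, $(i,j)\in\mathcal E$. Put $P_{g}=I_d-gg^T$. The leaders move with given positions $p_i(t)$ and constant velocities $v_i(t)\equiv v_i$, $i\in\mathcal V_\ell$, $t\ge 0$. Suppose that there is a target formation $p^*(t)$, i.e. for all $t\ge0$: $p_i^*(t)\ne p_j^*(t)$ and $(p_j^*(t)-p_i^*(t))/\|p_j^*(t)-p_i^*(t)\|=g_{ij}^*$ for all $(i,j)\in\mathcal E$, and $p_i^*(t)=p_i(t)$ for $i\in\mathcal V_\ell$. Let $\mathcal L\in\mathbb{R}^{dn\times dn}$, $n=n_\ell+n_f$, be the bearing Laplacian, whose $(i,j)$ block is $-P_{g_{ij}^*}$ if $i\ne j$ and $(i,j)\in\mathcal E$, is $0$ if $i\neq j$ and $(i,j)\notin\mathcal E$, and is $\sum_{k\in\mathcal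 N_i}P_{g_{ik}^*}$ if $i=j$; assume that its follower-follower block $\mathcal L_{ff}$ is nonsingular (so that the target formation is unique). Let $k_p,k_v,\beta>0$, and let $\mathrm{sat}$ be either $\mathrm{sat}(x)=\mathrm{sign}(x)\min\{|x|,\beta\}$ or $\mathrm{sat}(x)=\beta\tanh(x)$, applied component-wise to vectors. Let the followers be double integrators $\dot p_i=v_i$, $\dot v_i=u_i$ on $[0,\infty)$ under the saturated control law $$u_i=\mathrm{sat}\Big(-\sum_{j\in\mathcal N_i}P_{g_{ij}^*}\big[k_p(p_i-p_j)+k_v(v_i-v_j)\big]\Big),\qquad i\in\mathcal V_f .$$ Then $p_f^*$ is differentiable on $[0,\infty)$ and, with $v_f^*=\dot p_f^*$, the tracking errors $\delta_p(t)=p_f(t)-p_f^*(t)$ and $\delta_v(t)=v_f(t)-v_f^*(t)$ globally and asymptotically converge to zero: for every trajectory, whatever the initial positions and velocities of the followers, $\delta_p(t)\to0$ and $\delta_v(t)\to0$ as $t\to\infty$; moreover zero error is Lyapunov stable, i.e. for every $\varepsilon>0$ there is $\eta>0$ such that every trajectory with $\|\delta_p(0)\|<\eta$ and $\|\delta_v(0)\|<\eta$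 satisfies $\|\delta_p(t)\|<\varepsilon$ and $\|\delta_v(t)\|<\varepsilon$ for all $t\ge0$. -/

import Mathlib

open Filter Topology Set

noncomputable section

/-- Points and vectors of `ℝᵈ` with the Euclidean norm. -/
abbrev Vec (d : ℕ) : Type := EuclideanSpace ℝ (Fin d)

/-- The agents: `nl` leaders (`Sum.inl`) followed by `nf` followers (`Sum.inr`). -/
abbrev Agent (nl nf : ℕ) : Type := Fin nl ⊕ Fin nf

/-- The bearing `(q - p) / ‖q - p‖` of the point `q` relative to the point `p`
(meaningful for `p ≠ q`). -/
def bearing {d : ℕ} (p q : Vec d) : Vec d := ‖q - p‖⁻¹ • (q - p)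

/-- The matrix `P_g = I - g gᵀ`. -/
def bearingProj {d : ℕ} (g : Vec d) : Matrix (Fin d) (Fin d) ℝ :=
  1 - Matrix.vecMulVec g.ofLp g.ofLp

/-- The neighbours `{j | (i, j) ∈ E}` of agent `i`. -/
def nbrs {nl nf : ℕ} (E : Finset (Agent nl nf × Agent nl nf)) (i : Agent nl nf) :
    Finset (Agent nl nf) :=
  Finset.univ.filter fun j => (i, j) ∈ E

/-- The information flow between any two followers is bidirectional. -/
def FollowersBidirectional {nl nf : ℕ} (E : Finset (Agent nl nf × Agent nl nf)) : Prop :=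
  ∀ i j : Fin nf, (Sum.inr i, Sum.inr j) ∈ E → (Sum.inr j, Sum.inr i) ∈ E

/-- The bearing Laplacian, a `dn × dn` matrix whose rows and columns are indexed by pairs
(agent, coordinate). -/
def bearingLaplacian {d nl nf : ℕ} (E : Finset (Agent nl nf × Agent nl nf))
    (g : Agent nl nf → Agent nl nf → Vec d) :
    Matrix (Agent nl nf × Fin d) (Agent nl nf × Fin d) ℝ :=
  Matrix.of fun x y =>
    if x.1 = y.1 then ∑ k ∈ nbrs E x.1, bearingProj (g x.1 k) x.2 y.2
    else if (x.1, y.1) ∈ E then -bearingProj (g x.1 y.1) x.2 y.2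
    else 0

/-- The follower-follower block of the bearing Laplacian. -/
def laplacianFF {d nl nf : ℕ} (E : Finset (Agent nl nf × Agent nl nf))
    (g : Agent nl nf → Agent nl nf → Vec d) :
    Matrix (Fin nf × Fin d) (Fin nf × Fin d) ℝ :=
  (bearingLaplacian E g).submatrix (Prod.map Sum.inr id) (Prod.map Sum.inr id)

/-- `ps` is a target formation, for all `t ≥ 0`, for the constant desired bearings `g` and the
leader positions `pl`. -/
structure IsTargetFormation {d nl nf : ℕ} (E : Finset (Agent nl nf × Agent nl nf))
    (g : Agent nl nf → Agent nl nf → Vec d) (pl : ℝ → Fin nl → Vec d)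
    (ps : ℝ → Agent nl nf → Vec d) : Prop where
  /-- the bearings along edges are well defined -/
  ne : ∀ t, 0 ≤ t → ∀ i j, (i, j) ∈ E → ps t i ≠ ps t j
  bearing_eq : ∀ t, 0 ≤ t → ∀ i j, (i, j) ∈ E → bearing (ps t i) (ps t j) = g i j
  leader : ∀ t, 0 ≤ t → ∀ i, ps t (Sum.inl i) = pl t i

/-- `sat` is one of the two saturation functions with bound `β`: either
`x ↦ sign x * min |x| β` or `x ↦ β * tanh x`. -/
def IsSaturation (β : ℝ) (sat : ℝ → ℝ) : Prop :=
  (∀ x, sat x = Real.sign x * min |x| β) ∨ (∀ x, sat x = β * Real.tanh x)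

/-- The component-wise extension of `sat` to vectors. -/
def satVec {d : ℕ} (sat : ℝ → ℝ) (x : Vec d) : Vec d := WithLp.toLp 2 fun a => sat (x a)

/-- The saturated control input of agent `i` in the state `(p, v)`. -/
def saturatedControl {d nl nf : ℕ} (E : Finset (Agent nl nf × Agent nl nf))
    (g : Agent nl nf → Agent nl nf → Vec d) (sat : ℝ → ℝ) (kp kv : ℝ)
    (p v : Agent nl nf → Vec d) (i : Agent nl nf) : Vec d :=
  satVec sat (-∑ j ∈ nbrs E i,
    WithLp.toLp 2 ((bearingProj (g i j)).mulVec (kp • (p i - p j) + kv • (v i - v j)).ofLp))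

/-- `(p, v)` is a trajectory on `[0, ∞)` of the closed-loop system: the leaders move as prescribed
by `(pl, vl)`, and every follower is a double integrator driven by the saturated control law. -/
structure IsClosedLoopTrajectory {d nl nf : ℕ} (E : Finset (Agent nl nf × Agent nl nf))
    (g : Agent nl nf → Agent nl nf → Vec d) (sat : ℝ → ℝ) (kp kv : ℝ)
    (pl vl : ℝ → Fin nl → Vec d) (p v : ℝ → Agent nl nf → Vec d) : Prop where
  leader_pos : ∀ t, 0 ≤ t → ∀ i, p t (Sum.inl i) = pl t i
  leader_vel : ∀ t, 0 ≤ t → ∀ i, v t (Sum.inl i) = vl t i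
  follower_pos : ∀ t, 0 ≤ t → ∀ i : Fin nf,
    HasDerivWithinAt (fun s => p s (Sum.inr i)) (v t (Sum.inr i)) (Ici 0) t
  follower_vel : ∀ t, 0 ≤ t → ∀ i : Fin nf,
    HasDerivWithinAt (fun s => v s (Sum.inr i))
      (saturatedControl E g sat kp kv (p t) (v t) (Sum.inr i)) (Ici 0) t

/-- The position tracking error `p_f - p_f*` of the followers. -/
def posError {d nl nf : ℕ} (p ps : ℝ → Agent nl nf → Vec d) (t : ℝ) : Fin nf → Vec d :=
  fun i => p t (Sum.inr i) - ps t (Sum.inr i)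

/-- The velocity tracking error `v_f - v_f*` of the followers, where `v_f*` is the (one-sided
at `t = 0`) time derivative of `p_f*`. -/
def velError {d nl nf : ℕ} (v ps : ℝ → Agent nl nf → Vec d) (t : ℝ) : Fin nf → Vec d :=
  fun i => v t (Sum.inr i) - derivWithin (fun s => ps s (Sum.inr i)) (Ici 0) t

end

/-! Each target edge vector is parallel to its bearing, so the follower rows of the Laplacian
annihilate `ps t`. With the follower block `B` invertible, the target followers are a fixed linear
image `G` of the leaders and hence move with constant velocity. The errors therefore satisfy `δ' =
η`, `η' = sat(-B (kp δ + kv η))`. The matrix `B` is symmetric positive definite: follower edges are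
bidirectional with opposite bearings, `P_g` is an orthogonal projection, and `B` is injective.

In the variables `y = B (kp δ + kv η)` and `η`, with `S` the component-wise saturation, the system
reads `y' = kp B η - kv B S(y)`, `η' = -S(y)`. As `S` is the gradient of a potential `Φ`, the energy
`Φ(y) + (kp/2)⟪B η, η⟫` has derivative `-kv ⟪B S(y), S(y)⟫`. This is only semidefinite; instead of
an invariance principle, a small cross term `-c ⟪y, η⟫` is added, which produces dissipation in `η`
as well. On bounded sets of initial data this gives exponential decay
(`exponential_decay_of_isSectorGradient`), whence both attraction and stability. The two saturations
enter only through the bounds `m x / (1 + x) ≤ sat x ≤ K x` for `x ≥ 0`, oddness and continuity. -/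

noncomputable section

/-! ### Strict Lyapunov function and exponential decay -/

/-- A nonlinearity `S` on an inner product space which is the gradient, along curves, of a
potential `Φ` that is locally equivalent to `‖y‖ ^ 2` and coercive. -/
structure IsSectorGradient {H : Type*} [NormedAddCommGroup H] [InnerProductSpace ℝ H]
    (S : H → H) (Φ : H → ℝ) : Prop where
  hasDeriv : ∀ (y : ℝ → H) (y' : H) (t : ℝ), HasDerivWithinAt y y' (Ici 0) t →
    HasDerivWithinAt (fun s => Φ (y s)) (inner ℝ (S (y t)) y') (Ici 0) t
  upper : ∃ K > 0, ∀ y, Φ y ≤ K * ‖y‖ ^ 2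
  lower : ∀ R : ℝ, ∃ a > 0, ∀ y, ‖y‖ ≤ R → a * ‖y‖ ^ 2 ≤ Φ y ∧ a * ‖y‖ ≤ ‖S y‖
  coercive : ∀ C : ℝ, ∃ R : ℝ, ∀ y, Φ y ≤ C → ‖y‖ ≤ R

/-- Grönwall's inequality for a scalar function with `U' ≤ -l U` on `[0, ∞)`. -/
theorem le_mul_exp_neg_of_deriv_le {U U' : ℝ → ℝ} {l : ℝ}
    (hU : ∀ t, 0 ≤ t → HasDerivWithinAt U (U' t) (Ici 0) t)
    (hle : ∀ t, 0 ≤ t → U' t ≤ -l * U t) {t : ℝ} (ht : 0 ≤ t) :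
    U t ≤ U 0 * Real.exp (-l * t) := by
  have hd : ∀ s, 0 ≤ s → HasDerivWithinAt (fun s => U s * Real.exp (l * s))
      (U' s * Real.exp (l * s) + U s * (Real.exp (l * s) * l)) (Ici 0) s := by
    intro s hs
    have h1 : HasDerivAt (fun s : ℝ => Real.exp (l * s)) (Real.exp (l * s) * l) s := by
      simpa using ((hasDerivAt_id s).const_mul l).exp
    exact (hU s hs).mul h1.hasDerivWithinAt
  have hanti : AntitoneOn (fun s => U s * Real.exp (l * s)) (Ici 0) := by
    apply antitoneOn_of_hasDerivWithinAt_nonpos (convex_Ici 0)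
      (fun s hs => (hd s hs).continuousWithinAt)
      (f' := fun s => U' s * Real.exp (l * s) + U s * (Real.exp (l * s) * l))
    · intro s hs
      rw [interior_Ici] at hs ⊢
      exact (hd s hs.le).mono Ioi_subset_Ici_self
    · intro s hs
      rw [interior_Ici] at hs
      have := hle s hs.le
      have he := Real.exp_pos (l * s)
      nlinarith
  have h := hanti (mem_Ici.2 le_rfl) (mem_Ici.2 ht) ht
  simp only [mul_zero, Real.exp_zero, mul_one] at h
  rw [neg_mul, Real.exp_neg, ← div_eq_mul_inv, le_div_iff₀ (Real.exp_pos _)]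
  exact h

section Decay

variable {H : Type*} [NormedAddCommGroup H] [InnerProductSpace ℝ H]

set_option maxHeartbeats 1000000 in
/-- Local exponential decay, uniform on bounded sets of initial data, of `y' = kp A η - kv A S(y)`,
`η' = -S(y)` for a symmetric coercive `A`. -/
theorem exponential_decay_of_isSectorGradient {S : H → H} {Φ : H → ℝ} (hS : IsSectorGradient S Φ)
    {A : H →L[ℝ] H} (hA : ∀ x y, inner ℝ (A x) y = inner ℝ x (A y))
    {μ : ℝ} (hμ : 0 < μ) (hAμ : ∀ x, μ * ‖x‖ ^ 2 ≤ inner ℝ (A x) x)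
    {kp kv : ℝ} (hkp : 0 < kp) (hkv : 0 < kv) (C₀ : ℝ) :
    ∃ M > 0, ∃ l > 0, ∀ y η : ℝ → H,
      (∀ t, 0 ≤ t → HasDerivWithinAt y (kp • A (η t) - kv • A (S (y t))) (Ici 0) t) →
      (∀ t, 0 ≤ t → HasDerivWithinAt η (-S (y t)) (Ici 0) t) →
      ‖y 0‖ ^ 2 + ‖η 0‖ ^ 2 ≤ C₀ → ∀ t, 0 ≤ t →
        ‖y t‖ ^ 2 + ‖η t‖ ^ 2 ≤ M * (‖y 0‖ ^ 2 + ‖η 0‖ ^ 2) * Real.exp (-l * t) := by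
  obtain ⟨K, hK, hKΦ⟩ := hS.upper
  set N : ℝ := ‖A‖ with hN
  have hN0 : 0 ≤ N := norm_nonneg A
  have hAup : ∀ x, inner ℝ (A x) x ≤ N * ‖x‖ ^ 2 := fun x => by
    calc inner ℝ (A x) x ≤ ‖A x‖ * ‖x‖ := real_inner_le_norm _ _
      _ ≤ (N * ‖x‖) * ‖x‖ := by gcongr; exact A.le_opNorm x
      _ = N * ‖x‖ ^ 2 := by ring
  -- This level bounds the initial energy, so nonincrease of the energy confines `y` to the ball of
  -- radius `R`, where the local lower bounds with constant `a` hold.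
  obtain ⟨R, hR⟩ := hS.coercive ((K + kp / 2 * N) * C₀)
  obtain ⟨a, ha, haR⟩ := hS.lower R
  -- `c * B * ‖S y‖ ^ 2` is what the cross term costs in the derivative. The weight `c` is chosen so
  -- that this uses at most half of the dissipation (`c * B ≤ kv * μ / 2`) and so that the cross
  -- term uses at most half of the energy (`c ≤ q`).
  set B : ℝ := 1 / a + (kv * N) ^ 2 / (2 * (kp * μ)) with hB
  have hkμ : 0 < kp * μ := mul_pos hkp hμ
  have hvμ : 0 < kv * μ := mul_pos hkv hμ
  have hB0 : 0 < B := by positivity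
  set q : ℝ := min a (kp * μ / 2) with hq
  have hq0 : 0 < q := lt_min ha (by positivity)
  set c : ℝ := min q (kv * μ / (2 * B)) with hc
  have hc0 : 0 < c := lt_min hq0 (by positivity)
  have hcB : c * B ≤ kv * μ / 2 := by
    have : c ≤ kv * μ / (2 * B) := min_le_right _ _
    calc c * B ≤ kv * μ / (2 * B) * B := by gcongr
      _ = kv * μ / 2 := by field_simp
  have hcq : c ≤ q := min_le_left _ _
  have hqa : q ≤ a := min_le_left _ _
  have hqk : q ≤ kp * μ / 2 := min_le_right _ _
  set α : ℝ := min (kv * μ / 2 * a ^ 2) (c * (kp * μ) / 2) with hα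
  have hα0 : 0 < α := lt_min (by positivity) (by positivity)
  have hα1 : α ≤ kv * μ / 2 * a ^ 2 := min_le_left _ _
  have hα2 : α ≤ c * (kp * μ) / 2 := min_le_right _ _
  set D : ℝ := K + kp / 2 * N + c / 2 with hD
  have hD0 : 0 < D := by positivity
  clear_value c q α
  refine ⟨D / (q / 2), by positivity, α / D, by positivity, ?_⟩
  intro y η hy hη h0
  have hAη : ∀ t, 0 ≤ t → HasDerivWithinAt (fun s => A (η s)) (A (-S (y t))) (Ici 0) t :=
    fun t ht => A.hasFDerivAt.comp_hasDerivWithinAt t (hη t ht)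
  have hV : ∀ t, 0 ≤ t → HasDerivWithinAt
      (fun s => Φ (y s) + kp / 2 * inner ℝ (A (η s)) (η s))
      (-(kv * inner ℝ (A (S (y t))) (S (y t)))) (Ici 0) t := by
    intro t ht
    have h1 := hS.hasDeriv y _ t (hy t ht)
    have h2 := ((hAη t ht).inner ℝ (hη t ht)).const_mul (kp / 2)
    refine (h1.add h2).congr_deriv ?_
    simp only [inner_sub_right, inner_smul_right, map_neg, inner_neg_right, inner_neg_left]
    -- By symmetry of `A`, the term `kp ⟪S y, A η⟫` from the potential cancels against the
    -- derivative of the quadratic part.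
    rw [hA (S (y t)) (η t), real_inner_comm (S (y t)) (A (η t)), real_inner_comm (S (y t)) (A (S (y t)))]
    ring
  have hVle : ∀ t, 0 ≤ t → ‖y t‖ ≤ R := by
    intro t ht
    -- Rate `0` turns Grönwall's inequality into monotonicity of the energy.
    have hg := le_mul_exp_neg_of_deriv_le (l := 0) hV (fun s _ => by
      have := hAμ (S (y s))
      have : 0 ≤ inner ℝ (A (S (y s))) (S (y s)) := le_trans (by positivity) this
      have := mul_nonneg hkv.le this
      linarith) ht
    simp only [neg_zero, zero_mul, Real.exp_zero, mul_one] at hg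
    apply hR
    have h1 : 0 ≤ inner ℝ (A (η t)) (η t) := le_trans (by positivity) (hAμ (η t))
    have h2 := hKΦ (y 0)
    have h3 := hAup (η 0)
    have h4 : kp / 2 * inner ℝ (A (η 0)) (η 0) ≤ kp / 2 * (N * ‖η 0‖ ^ 2) := by gcongr
    have h5 : 0 ≤ kp / 2 * inner ℝ (A (η t)) (η t) := by positivity
    have h6 : (K + kp / 2 * N) * (‖y 0‖ ^ 2 + ‖η 0‖ ^ 2) ≤ (K + kp / 2 * N) * C₀ := by gcongr
    have h7 : 0 ≤ kp / 2 * N * ‖y 0‖ ^ 2 := by positivity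
    have h8 : 0 ≤ K * ‖η 0‖ ^ 2 := by positivity
    nlinarith
  have hcross : ∀ t, |inner ℝ (y t) (η t)| ≤ (‖y t‖ ^ 2 + ‖η t‖ ^ 2) / 2 := fun t => by
    have h1 := abs_real_inner_le_norm (y t) (η t)
    nlinarith [sq_nonneg (‖y t‖ - ‖η t‖)]
  have hUlow : ∀ t, 0 ≤ t → q / 2 * (‖y t‖ ^ 2 + ‖η t‖ ^ 2) ≤
      Φ (y t) + kp / 2 * inner ℝ (A (η t)) (η t) - c * inner ℝ (y t) (η t) := by
    intro t ht
    have h1 := (haR (y t) (hVle t ht)).1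
    have h2 : kp / 2 * (μ * ‖η t‖ ^ 2) ≤ kp / 2 * inner ℝ (A (η t)) (η t) := by
      gcongr; exact hAμ _
    have h3 : c * inner ℝ (y t) (η t) ≤ q * ((‖y t‖ ^ 2 + ‖η t‖ ^ 2) / 2) :=
      calc c * inner ℝ (y t) (η t) ≤ c * ((‖y t‖ ^ 2 + ‖η t‖ ^ 2) / 2) := by
            gcongr; exact (le_abs_self _).trans (hcross t)
        _ ≤ _ := by gcongr
    have h4 : q * ‖y t‖ ^ 2 ≤ a * ‖y t‖ ^ 2 := by gcongr
    have h5 : q * ‖η t‖ ^ 2 ≤ kp * μ / 2 * ‖η t‖ ^ 2 := by gcongr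
    linarith
  have hUup : ∀ t, Φ (y t) + kp / 2 * inner ℝ (A (η t)) (η t) - c * inner ℝ (y t) (η t) ≤
      D * (‖y t‖ ^ 2 + ‖η t‖ ^ 2) := by
    intro t
    have h1 := hKΦ (y t)
    have h2 : kp / 2 * inner ℝ (A (η t)) (η t) ≤ kp / 2 * (N * ‖η t‖ ^ 2) := by
      gcongr; exact hAup _
    have h3 : c * -inner ℝ (y t) (η t) ≤ c * ((‖y t‖ ^ 2 + ‖η t‖ ^ 2) / 2) := by
      gcongr; exact (neg_le_abs _).trans (hcross t)
    have h7 : 0 ≤ kp / 2 * N * ‖y t‖ ^ 2 := by positivity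
    have h8 : 0 ≤ K * ‖η t‖ ^ 2 := by positivity
    rw [hD]
    nlinarith
  have hU : ∀ t, 0 ≤ t → HasDerivWithinAt
      (fun s => Φ (y s) + kp / 2 * inner ℝ (A (η s)) (η s) - c * inner ℝ (y s) (η s))
      (-(kv * inner ℝ (A (S (y t))) (S (y t))) - c * (kp * inner ℝ (A (η t)) (η t) -
        kv * inner ℝ (A (S (y t))) (η t) - inner ℝ (y t) (S (y t)))) (Ici 0) t := by
    intro t ht
    refine ((hV t ht).sub (((hy t ht).inner ℝ (hη t ht)).const_mul c)).congr_deriv ?_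
    simp only [inner_sub_left, real_inner_smul_left, inner_neg_right]
    ring
  have hdecay := fun (t : ℝ) (ht : 0 ≤ t) => le_mul_exp_neg_of_deriv_le (l := α / D) hU (fun s hs => by
    have hlow := (haR (y s) (hVle s hs)).2
    set σ := S (y s)
    have h1 : kv * (μ * ‖σ‖ ^ 2) ≤ kv * inner ℝ (A σ) σ := by gcongr; exact hAμ _
    have h2 : c * (kp * (μ * ‖η s‖ ^ 2)) ≤ c * (kp * inner ℝ (A (η s)) (η s)) := by
      gcongr; exact hAμ _
    have h3 : kv * inner ℝ (A σ) (η s) ≤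
        kp * μ / 2 * ‖η s‖ ^ 2 + (kv * N) ^ 2 / (2 * (kp * μ)) * ‖σ‖ ^ 2 := by
      have h31 : inner ℝ (A σ) (η s) ≤ N * ‖σ‖ * ‖η s‖ :=
        (real_inner_le_norm _ _).trans (by gcongr; exact A.le_opNorm _)
      have h32 : kv * inner ℝ (A σ) (η s) ≤ kv * (N * ‖σ‖ * ‖η s‖) := by gcongr
      refine h32.trans ?_
      -- Young's inequality, weighted to consume exactly half of the gained `kp * μ * ‖η‖ ^ 2`.
      have h33 : kp * μ / 2 * ‖η s‖ ^ 2 + (kv * N) ^ 2 / (2 * (kp * μ)) * ‖σ‖ ^ 2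
          - kv * (N * ‖σ‖ * ‖η s‖) = (kp * μ * ‖η s‖ - kv * N * ‖σ‖) ^ 2 / (2 * (kp * μ)) := by
        field_simp
        ring
      have h34 : 0 ≤ (kp * μ * ‖η s‖ - kv * N * ‖σ‖) ^ 2 / (2 * (kp * μ)) := by positivity
      linarith
    have h4 : inner ℝ (y s) σ ≤ 1 / a * ‖σ‖ ^ 2 := by
      have h41 : ‖y s‖ ≤ ‖σ‖ / a := by rw [le_div_iff₀ ha]; linarith
      calc inner ℝ (y s) σ ≤ ‖y s‖ * ‖σ‖ := real_inner_le_norm _ _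
        _ ≤ ‖σ‖ / a * ‖σ‖ := by gcongr
        _ = _ := by ring
    have h5 : c * (kv * inner ℝ (A σ) (η s) + inner ℝ (y s) σ) ≤
        c * (kp * μ / 2 * ‖η s‖ ^ 2 + B * ‖σ‖ ^ 2) := by
      refine mul_le_mul_of_nonneg_left ?_ hc0.le
      rw [hB, add_mul]
      linarith
    have h6 : c * B * ‖σ‖ ^ 2 ≤ kv * μ / 2 * ‖σ‖ ^ 2 := by gcongr
    have h7 : kv * μ / 2 * (a * ‖y s‖) ^ 2 ≤ kv * μ / 2 * ‖σ‖ ^ 2 := by gcongr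
    have h8 : α * ‖y s‖ ^ 2 ≤ kv * μ / 2 * a ^ 2 * ‖y s‖ ^ 2 := by gcongr
    have h9 : α * ‖η s‖ ^ 2 ≤ c * (kp * μ) / 2 * ‖η s‖ ^ 2 := by gcongr
    have h10 : α / D * (Φ (y s) + kp / 2 * inner ℝ (A (η s)) (η s) - c * inner ℝ (y s) (η s)) ≤
        α * (‖y s‖ ^ 2 + ‖η s‖ ^ 2) := by
      calc _ ≤ α / D * (D * (‖y s‖ ^ 2 + ‖η s‖ ^ 2)) := by gcongr; exact hUup s
        _ = _ := by field_simp
    linarith) ht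
  intro t ht
  have h1 := hUlow t ht
  have h2 := hdecay t ht
  have h3 : (Φ (y 0) + kp / 2 * inner ℝ (A (η 0)) (η 0) - c * inner ℝ (y 0) (η 0)) *
      Real.exp (-(α / D) * t) ≤ D * (‖y 0‖ ^ 2 + ‖η 0‖ ^ 2) * Real.exp (-(α / D) * t) := by
    gcongr
    exact hUup 0
  have h4 : q / 2 * (‖y t‖ ^ 2 + ‖η t‖ ^ 2) ≤
      D * (‖y 0‖ ^ 2 + ‖η 0‖ ^ 2) * Real.exp (-(α / D) * t) := by linarith
  rw [← le_div_iff₀' (by positivity)] at h4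
  refine h4.trans (le_of_eq ?_)
  ring

end Decay

/-! ### Saturation functions and their potentials -/

/-- The properties shared by the two saturation functions. -/
structure IsSectorFunction (m K : ℝ) (sat : ℝ → ℝ) : Prop where
  cont : Continuous sat
  odd : ∀ x, sat (-x) = -sat x
  lower : ∀ x, 0 ≤ x → m * x / (1 + x) ≤ sat x
  upper : ∀ x, 0 ≤ x → sat x ≤ K * x

theorem sign_mul_min_abs_eq_max_min {β : ℝ} (hβ : 0 < β) (x : ℝ) :
    Real.sign x * min |x| β = max (-β) (min x β) := by
  rcases lt_trichotomy x 0 with h | h | h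
  · rw [Real.sign_of_neg h, abs_of_neg h, min_eq_left (by linarith : x ≤ β), neg_one_mul,
      ← max_neg_neg, neg_neg, max_comm]
  · subst h
    simp [hβ.le]
  · rw [Real.sign_of_pos h, abs_of_pos h, one_mul, max_eq_right]
    have : 0 ≤ min x β := le_min h.le hβ.le
    linarith

theorem tanh_eq_one_sub (x : ℝ) : Real.tanh x = 1 - 2 / (Real.exp (2 * x) + 1) := by
  have h1 : Real.exp (2 * x) = Real.exp x * Real.exp x := by rw [← Real.exp_add]; ring_nf
  have h2 := Real.exp_pos x
  rw [Real.tanh_eq, h1, Real.exp_neg]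
  field_simp
  ring

/-- For the clipped identity, `m = min 1 β` keeps `m x / (1 + x)` below both `x` and `β`. For
`tanh`, everything follows from `1 + u ≤ exp u` at `u = 2x` (lower bound, `m = β`) and at `u = -2x`
(upper bound, with the non-sharp `K = 2β`). -/
theorem IsSaturation.isSectorFunction {β : ℝ} (hβ : 0 < β) {sat : ℝ → ℝ}
    (h : IsSaturation β sat) : ∃ m > 0, ∃ K > 0, IsSectorFunction m K sat := by
  rcases h with h | h
  · refine ⟨min 1 β, lt_min one_pos hβ, 1, one_pos, ?_, ?_, ?_, ?_⟩
    · have : sat = fun x => max (-β) (min x β) :=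
        funext fun x => (h x).trans (sign_mul_min_abs_eq_max_min hβ x)
      rw [this]
      fun_prop
    · intro x
      rw [h, h, Real.sign_neg, abs_neg, neg_mul]
    · intro x hx
      rw [h, sign_mul_min_abs_eq_max_min hβ]
      refine le_trans (le_min ?_ ?_) (le_max_right _ _)
      · rw [div_le_iff₀ (by positivity)]
        have : min 1 β ≤ 1 := min_le_left _ _
        nlinarith [mul_le_mul_of_nonneg_right this hx]
      · rw [div_le_iff₀ (by positivity)]
        have : min 1 β ≤ β := min_le_right _ _
        nlinarith [mul_le_mul_of_nonneg_right this hx]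
    · intro x hx
      rw [h, sign_mul_min_abs_eq_max_min hβ, one_mul]
      exact max_le (by linarith) (min_le_left _ _)
  · refine ⟨β, hβ, 2 * β, by positivity, ?_, ?_, ?_, ?_⟩
    · have : sat = fun x => β * (1 - 2 / (Real.exp (2 * x) + 1)) :=
        funext fun x => (h x).trans (by rw [tanh_eq_one_sub])
      rw [this]
      have : ∀ x : ℝ, Real.exp (2 * x) + 1 ≠ 0 := fun x => by positivity
      fun_prop (disch := exact this _)
    · intro x
      rw [h, h, Real.tanh_neg, mul_neg]
    · intro x hx
      rw [h, tanh_eq_one_sub, mul_div_assoc]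
      gcongr
      have h1 := Real.add_one_le_exp (2 * x)
      have h2 : 2 / (Real.exp (2 * x) + 1) ≤ 2 / (2 * x + 1 + 1) := by gcongr
      have h3 : x / (1 + x) = 1 - 2 / (2 * x + 1 + 1) := by field_simp; ring
      linarith
    · intro x hx
      rw [h, tanh_eq_one_sub]
      have h1 := Real.add_one_le_exp (-(2 * x))
      rw [Real.exp_neg] at h1
      have h0 := Real.exp_pos (2 * x)
      have h4 : 1 ≤ Real.exp (2 * x) := Real.one_le_exp (by positivity)
      have h2 : (Real.exp (2 * x))⁻¹ ≤ 2 / (Real.exp (2 * x) + 1) := by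
        rw [inv_eq_one_div, div_le_div_iff₀ h0 (by positivity)]
        linarith
      have h3 : 1 - 2 / (Real.exp (2 * x) + 1) ≤ 2 * x := by linarith
      nlinarith [mul_le_mul_of_nonneg_left h3 hβ.le]

/-- The primitive of `sat` vanishing at `0`. -/
def satPotential (sat : ℝ → ℝ) (y : ℝ) : ℝ := ∫ x in (0 : ℝ)..y, sat x

namespace IsSectorFunction

variable {m K : ℝ} {sat : ℝ → ℝ}

theorem abs_sat (h : IsSectorFunction m K sat) (hm : 0 < m) (x : ℝ) : |sat x| = sat |x| := by
  have hpos : ∀ x, 0 ≤ x → 0 ≤ sat x := fun x hx => le_trans (by positivity) (h.lower x hx)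
  rcases le_total 0 x with hx | hx
  · rw [abs_of_nonneg hx, abs_of_nonneg (hpos x hx)]
  · rw [abs_of_nonpos hx, h.odd, abs_of_nonpos]
    have := hpos (-x) (by linarith)
    rw [h.odd] at this
    linarith

theorem hasDerivAt_potential (h : IsSectorFunction m K sat) (y : ℝ) :
    HasDerivAt (satPotential sat) (sat y) y :=
  intervalIntegral.integral_hasDerivAt_right (h.cont.intervalIntegrable _ _)
    (h.cont.stronglyMeasurableAtFilter _ _) h.cont.continuousAt

theorem potential_neg (h : IsSectorFunction m K sat) (y : ℝ) :
    satPotential sat (-y) = satPotential sat y := by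
  have h1 := intervalIntegral.integral_comp_neg (a := 0) (b := y) sat
  simp only [h.odd, intervalIntegral.integral_neg, neg_zero] at h1
  rw [satPotential, satPotential, intervalIntegral.integral_symm, ← h1, neg_neg]

theorem potential_abs (h : IsSectorFunction m K sat) (y : ℝ) :
    satPotential sat |y| = satPotential sat y := by
  rcases abs_choice y with hy | hy <;> rw [hy]
  exact h.potential_neg y

theorem potential_upper (h : IsSectorFunction m K sat) (y : ℝ) :
    satPotential sat y ≤ K / 2 * y ^ 2 := by
  rw [← h.potential_abs, ← sq_abs]
  have hd : ∀ x, HasDerivAt (fun x => K / 2 * x ^ 2 - satPotential sat x) (K * x - sat x) x := by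
    intro x
    refine (((hasDerivAt_pow 2 x).const_mul (K / 2)).sub (h.hasDerivAt_potential x)).congr_deriv ?_
    norm_num
    ring
  have hmono : MonotoneOn (fun x => K / 2 * x ^ 2 - satPotential sat x) (Ici 0) := by
    apply monotoneOn_of_hasDerivWithinAt_nonneg (convex_Ici 0)
      (fun x _ => (hd x).continuousAt.continuousWithinAt) (fun x _ => (hd x).hasDerivWithinAt)
    intro x hx
    rw [interior_Ici] at hx
    linarith [h.upper x (le_of_lt hx)]
  have := hmono (mem_Ici.2 le_rfl) (mem_Ici.2 (abs_nonneg y)) (abs_nonneg y)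
  simp only [satPotential, intervalIntegral.integral_same] at this ⊢
  linarith

/-- On `x ≥ 0` the derivative of `m / 2 * (x ^ 2 / (1 + x))` is at most `m x / (1 + x) ≤ sat x`;
evenness of the potential covers negative arguments. The bound is quadratic near `0` and linear at
infinity, as boundedness of the saturation requires. -/
theorem potential_lower (h : IsSectorFunction m K sat) (hm : 0 < m) (y : ℝ) :
    m / 2 * (y ^ 2 / (1 + |y|)) ≤ satPotential sat y := by
  rw [← h.potential_abs, ← sq_abs]
  have hd : ∀ x, 0 ≤ x → HasDerivAt (fun x => satPotential sat x - m / 2 * (x ^ 2 / (1 + x)))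
      (sat x - m / 2 * ((2 * x * (1 + x) - x ^ 2) / (1 + x) ^ 2)) x := by
    intro x hx
    have h1 : HasDerivAt (fun x : ℝ => x ^ 2 / (1 + x))
        ((2 * x * (1 + x) - x ^ 2) / (1 + x) ^ 2) x := by
      refine ((hasDerivAt_pow 2 x).div ((hasDerivAt_id x).const_add 1)
        (by simp only [id]; positivity)).congr_deriv ?_
      simp
    exact (h.hasDerivAt_potential x).sub (h1.const_mul _)
  have hmono : MonotoneOn (fun x => satPotential sat x - m / 2 * (x ^ 2 / (1 + x))) (Ici 0) := by
    apply monotoneOn_of_hasDerivWithinAt_nonneg (convex_Ici 0)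
      (fun x hx => (hd x hx).continuousAt.continuousWithinAt)
      (fun x hx => (hd x (interior_subset hx)).hasDerivWithinAt)
    intro x hx
    rw [interior_Ici] at hx
    have hx : 0 < x := hx
    have h1 := h.lower x hx.le
    have h2 : m / 2 * ((2 * x * (1 + x) - x ^ 2) / (1 + x) ^ 2) ≤ m * x / (1 + x) := by
      have : m * x / (1 + x) - m / 2 * ((2 * x * (1 + x) - x ^ 2) / (1 + x) ^ 2) =
          m * x ^ 2 / (2 * (1 + x) ^ 2) := by field_simp; ring
      have : 0 ≤ m * x ^ 2 / (2 * (1 + x) ^ 2) := by positivity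
      linarith
    linarith
  have := hmono (mem_Ici.2 le_rfl) (mem_Ici.2 (abs_nonneg y)) (abs_nonneg y)
  simp only [satPotential, intervalIntegral.integral_same] at this ⊢
  norm_num at this ⊢
  linarith

/-- The component-wise nonlinearity is a gradient in the sector sense. -/
theorem isSectorGradient {ι : Type*} [Fintype ι] (h : IsSectorFunction m K sat) (hm : 0 < m)
    (hK : 0 < K) :
    IsSectorGradient (H := EuclideanSpace ℝ ι) (fun y => WithLp.toLp 2 fun i => sat (y i))
      (fun y => ∑ i, satPotential sat (y i)) := by
  have hcoord : ∀ (y : EuclideanSpace ℝ ι) i, |y i| ≤ ‖y‖ := fun y i => by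
    simpa using PiLp.norm_apply_le y i
  refine ⟨?_, ⟨K / 2, by positivity, ?_⟩, ?_, ?_⟩
  · intro y y' t hy
    have h1 : ∀ i, HasDerivWithinAt (fun s => y s i) (y' i) (Ici 0) t := fun i =>
      (EuclideanSpace.proj (𝕜 := ℝ) i).hasFDerivAt.comp_hasDerivWithinAt t hy
    have h2 := HasDerivWithinAt.fun_sum (u := Finset.univ) fun i _ =>
      (h.hasDerivAt_potential (y t i)).comp_hasDerivWithinAt t (h1 i)
    refine h2.congr_deriv ?_
    simp [PiLp.inner_apply, mul_comm]
  · intro y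
    rw [EuclideanSpace.real_norm_sq_eq, Finset.mul_sum]
    exact Finset.sum_le_sum fun i _ => h.potential_upper _
  · intro R
    have hR : 0 < 1 + |R| := by positivity
    -- Every coordinate is at most `|R|`, so `1 + |y i|` may be replaced by `1 + |R|`; the factor `1
    -- / 2` is needed only for the potential.
    refine ⟨m / 2 / (1 + |R|), by positivity, fun y hy => ⟨?_, ?_⟩⟩
    · rw [EuclideanSpace.real_norm_sq_eq, Finset.mul_sum]
      refine Finset.sum_le_sum fun i _ => le_trans ?_ (h.potential_lower hm _)
      have : |y i| ≤ |R| := (hcoord y i).trans (hy.trans (le_abs_self R))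
      rw [div_mul_eq_mul_div, ← mul_div_assoc]
      gcongr
    · refine le_of_sq_le_sq ?_ (norm_nonneg _)
      rw [mul_pow, EuclideanSpace.real_norm_sq_eq, EuclideanSpace.real_norm_sq_eq, Finset.mul_sum]
      refine Finset.sum_le_sum fun i _ => ?_
      rw [← mul_pow, sq_le_sq, abs_mul]
      have h1 : |y i| ≤ |R| := (hcoord y i).trans (hy.trans (le_abs_self R))
      simp only [h.abs_sat hm]
      refine le_trans ?_ (h.lower |y i| (abs_nonneg _))
      rw [abs_of_pos (by positivity), div_mul_eq_mul_div]
      gcongr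
      linarith
  · intro C
    set b := C / (m / 2) with hb
    -- Each summand of the potential is at most `C`, so `y i ^ 2 ≤ b * (1 + |y i|)`, which forces
    -- `|y i| ≤ |b| + 1`.
    refine ⟨∑ _i : ι, (|b| + 1), fun y hy => ?_⟩
    have hpos : ∀ i, 0 ≤ satPotential sat (y i) := fun i =>
      le_trans (by positivity) (h.potential_lower hm _)
    have h1 : ∀ i, |y i| ≤ |b| + 1 := fun i => by
      have h2 : satPotential sat (y i) ≤ C :=
        (Finset.single_le_sum (fun j _ => hpos j) (Finset.mem_univ i)).trans hy
      have h3 := (h.potential_lower hm (y i)).trans h2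
      rw [← le_div_iff₀' (by positivity), ← hb, div_le_iff₀ (by positivity), ← sq_abs] at h3
      have h4 := le_abs_self b
      have h5 := abs_nonneg (y i)
      by_contra hcon
      push Not at hcon
      nlinarith [mul_le_mul_of_nonneg_right h4 (by positivity : 0 ≤ 1 + |y i|), abs_nonneg b]
    have h6 : ‖y‖ ≤ ∑ i, |y i| := by
      refine le_of_sq_le_sq ?_ (by positivity)
      rw [EuclideanSpace.real_norm_sq_eq]
      simpa using Finset.sum_sq_le_sq_sum_of_nonneg (s := Finset.univ) (f := fun i => |y i|)
        fun i _ => abs_nonneg _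
    exact h6.trans (Finset.sum_le_sum fun i _ => h1 i)

end IsSectorFunction

/-! ### Bearing projections -/

/-- The linear map `x ↦ x - ⟪g, x⟫ g`, represented by the matrix `bearingProj g`. -/
def bearingProjLin {d : ℕ} (g : Vec d) : Vec d →ₗ[ℝ] Vec d :=
  LinearMap.id - (innerₛₗ ℝ g).smulRight g

section Projection

variable {d : ℕ}

theorem bearingProjLin_apply (g x : Vec d) :
    bearingProjLin g x = x - (inner ℝ g x : ℝ) • g := by
  simp [bearingProjLin]

theorem toLp_bearingProj_mulVec (g x : Vec d) :
    WithLp.toLp 2 ((bearingProj g).mulVec x.ofLp) = bearingProjLin g x := by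
  ext a
  simp [bearingProjLin_apply, bearingProj, Matrix.sub_mulVec, Matrix.vecMulVec_mulVec,
    PiLp.inner_apply, dotProduct, mul_comm]

theorem bearingProjLin_apply_coord (g x : Vec d) (a : Fin d) :
    bearingProjLin g x a = ∑ b, bearingProj g a b * x b := by
  rw [← toLp_bearingProj_mulVec]
  rfl

theorem bearingProjLin_neg (g : Vec d) : bearingProjLin (-g) = bearingProjLin g := by
  ext1 x
  simp [bearingProjLin_apply]

theorem inner_bearingProjLin_symm (g x y : Vec d) :
    inner ℝ (bearingProjLin g x) y = inner ℝ (bearingProjLin g y) x := by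
  simp only [bearingProjLin_apply, inner_sub_left, real_inner_smul_left]
  rw [real_inner_comm x y]
  ring

/-- For a unit vector the map is an orthogonal projection; this is the source of positivity of the
Laplacian form. -/
theorem inner_bearingProjLin_self {g : Vec d} (hg : ‖g‖ = 1) (x : Vec d) :
    inner ℝ (bearingProjLin g x) x = ‖bearingProjLin g x‖ ^ 2 := by
  rw [← real_inner_self_eq_norm_sq]
  simp only [bearingProjLin_apply, inner_sub_left, inner_sub_right, real_inner_smul_left,
    real_inner_smul_right, real_inner_self_eq_norm_sq g, hg]
  rw [real_inner_comm x g]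
  ring

theorem norm_bearing {p q : Vec d} (h : p ≠ q) : ‖bearing p q‖ = 1 := by
  have : ‖q - p‖ ≠ 0 := norm_ne_zero_iff.2 (sub_ne_zero.2 h.symm)
  rw [bearing, norm_smul, norm_inv, norm_norm, inv_mul_cancel₀ this]

theorem bearing_swap (p q : Vec d) : bearing q p = -bearing p q := by
  rw [bearing, bearing, norm_sub_rev, ← smul_neg, neg_sub]

theorem bearingProjLin_bearing_sub {p q : Vec d} (h : p ≠ q) :
    bearingProjLin (bearing p q) (p - q) = 0 := by
  have h1 : ‖q - p‖ ≠ 0 := norm_ne_zero_iff.2 (sub_ne_zero.2 h.symm)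
  have h2 : p - q = -(‖q - p‖ • bearing p q) := by
    rw [bearing, smul_smul, mul_inv_cancel₀ h1, one_smul, neg_sub]
  have h3 : bearingProjLin (bearing p q) (bearing p q) = 0 := by
    rw [bearingProjLin_apply, real_inner_self_eq_norm_sq, norm_bearing h]
    simp
  rw [h2, map_neg, map_smul, h3, smul_zero, neg_zero]

end Projection

/-! ### The follower block of the bearing Laplacian -/

variable {d nl nf : ℕ}

/-- The follower rows of the bearing Laplacian, as a linear map. -/
def followerLaplacian (E : Finset (Agent nl nf × Agent nl nf))
    (g : Agent nl nf → Agent nl nf → Vec d) :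
    (Agent nl nf → Vec d) →ₗ[ℝ] (Fin nf → Vec d) where
  toFun z i := ∑ j ∈ nbrs E (Sum.inr i), bearingProjLin (g (Sum.inr i) j) (z (Sum.inr i) - z j)
  map_add' z w := by
    funext i
    simp only [Pi.add_apply, ← Finset.sum_add_distrib, ← map_add]
    refine Finset.sum_congr rfl fun j _ => ?_
    congr 1
    abel
  map_smul' c z := by
    funext i
    simp only [Pi.smul_apply, ← smul_sub, map_smul, Finset.smul_sum, RingHom.id_apply]

theorem followerLaplacian_apply (E : Finset (Agent nl nf × Agent nl nf))
    (g : Agent nl nf → Agent nl nf → Vec d) (z : Agent nl nf → Vec d) (i : Fin nf) :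
    followerLaplacian E g z i =
      ∑ j ∈ nbrs E (Sum.inr i), bearingProjLin (g (Sum.inr i) j) (z (Sum.inr i) - z j) := rfl

/-- Extension of a follower configuration by zero on the leaders. -/
def extendFollowers : (Fin nf → Vec d) →ₗ[ℝ] (Agent nl nf → Vec d) :=
  LinearMap.pi (Sum.elim (fun _ => 0) fun i => LinearMap.proj i)

/-- Extension of a leader configuration by zero on the followers. -/
def extendLeaders : (Fin nl → Vec d) →ₗ[ℝ] (Agent nl nf → Vec d) :=
  LinearMap.pi (Sum.elim (fun i => LinearMap.proj i) fun _ => 0)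

@[simp] theorem extendFollowers_inl (x : Fin nf → Vec d) (i : Fin nl) :
    (extendFollowers x : Agent nl nf → Vec d) (Sum.inl i) = 0 := rfl

@[simp] theorem extendFollowers_inr (x : Fin nf → Vec d) (i : Fin nf) :
    (extendFollowers x : Agent nl nf → Vec d) (Sum.inr i) = x i := rfl

@[simp] theorem extendLeaders_inl (x : Fin nl → Vec d) (i : Fin nl) :
    (extendLeaders x : Agent nl nf → Vec d) (Sum.inl i) = x i := rfl

@[simp] theorem extendLeaders_inr (x : Fin nl → Vec d) (i : Fin nf) :
    (extendLeaders x : Agent nl nf → Vec d) (Sum.inr i) = 0 := rfl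

theorem extendLeaders_add_extendFollowers (z : Agent nl nf → Vec d) :
    extendLeaders (fun i => z (Sum.inl i)) + extendFollowers (fun i => z (Sum.inr i)) = z := by
  funext i
  rcases i with i | i <;> simp

/-- The follower-follower block of the bearing Laplacian, as a linear map. -/
def laplacianFFLin (E : Finset (Agent nl nf × Agent nl nf))
    (g : Agent nl nf → Agent nl nf → Vec d) : (Fin nf → Vec d) →ₗ[ℝ] (Fin nf → Vec d) :=
  followerLaplacian E g ∘ₗ extendFollowers

/-- Loops must be excluded: one would add a projector to the diagonal block of the matrix but
nothing to the sum of differences. -/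
theorem laplacianFFLin_apply_coord {E : Finset (Agent nl nf × Agent nl nf)}
    (hloop : ∀ i, (i, i) ∉ E) (g : Agent nl nf → Agent nl nf → Vec d) (x : Fin nf → Vec d)
    (i : Fin nf) (a : Fin d) :
    laplacianFFLin E g x i a = (laplacianFF E g).mulVec (fun y => x y.1 y.2) (i, a) := by
  have hentry : ∀ (j : Fin nf) (b : Fin d), laplacianFF E g (i, a) (j, b) =
      (if i = j then ∑ k ∈ nbrs E (Sum.inr i), bearingProj (g (Sum.inr i) k) a b else 0) -
      (if (Sum.inr i, Sum.inr j) ∈ E then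
        bearingProj (g (Sum.inr i) (Sum.inr j)) a b else 0) := by
    intro j b
    by_cases hij : i = j
    · subst hij
      simp [laplacianFF, bearingLaplacian, hloop]
    · by_cases hE : (Sum.inr i, Sum.inr j) ∈ E <;>
        simp [laplacianFF, bearingLaplacian, hij, hE]
  have hsum : (laplacianFF E g).mulVec (fun y => x y.1 y.2) (i, a) =
      ∑ b, (∑ k ∈ nbrs E (Sum.inr i), bearingProj (g (Sum.inr i) k) a b) * x i b -
      ∑ j, if (Sum.inr i, Sum.inr j) ∈ E then
        ∑ b, bearingProj (g (Sum.inr i) (Sum.inr j)) a b * x j b else 0 := by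
    simp only [Matrix.mulVec, dotProduct, Fintype.sum_prod_type, hentry, sub_mul,
      Finset.sum_sub_distrib]
    congr 1
    · rw [Finset.sum_comm]
      simp
    · refine Finset.sum_congr rfl fun j _ => ?_
      split_ifs <;> simp
  rw [hsum]
  simp only [laplacianFFLin, LinearMap.comp_apply, followerLaplacian_apply, map_sub,
    Finset.sum_sub_distrib, PiLp.sub_apply]
  congr 1
  · simp only [extendFollowers_inr, WithLp.ofLp_sum, Finset.sum_apply, bearingProjLin_apply_coord,
      Finset.sum_mul]
    exact Finset.sum_comm
  · simp only [nbrs, Finset.sum_filter, Fintype.sum_sum_type, extendFollowers_inl,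
      extendFollowers_inr, map_zero, ite_self, Finset.sum_const_zero, zero_add, WithLp.ofLp_sum,
      Finset.sum_apply]
    refine Finset.sum_congr rfl fun j _ => ?_
    split_ifs
    · rw [bearingProjLin_apply_coord]
    · rfl

theorem laplacianFFLin_injective {E : Finset (Agent nl nf × Agent nl nf)}
    (hloop : ∀ i, (i, i) ∉ E) {g : Agent nl nf → Agent nl nf → Vec d}
    (hL : (laplacianFF E g).det ≠ 0) : Function.Injective (laplacianFFLin E g) := by
  rw [← LinearMap.ker_eq_bot, LinearMap.ker_eq_bot']
  intro x hx
  have h1 : (laplacianFF E g).mulVec (fun y => x y.1 y.2) = 0 := by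
    funext ⟨i, a⟩
    rw [← laplacianFFLin_apply_coord hloop, hx]
    rfl
  have h2 := Matrix.eq_zero_of_mulVec_eq_zero hL h1
  funext i
  ext a
  exact congrFun h2 (i, a)

/-- The symmetric edge-wise expression of the bilinear form of the follower-follower block. -/
theorem sum_inner_laplacianFFLin {E : Finset (Agent nl nf × Agent nl nf)}
    (hE : FollowersBidirectional E) {g : Agent nl nf → Agent nl nf → Vec d}
    (hg : ∀ i j : Fin nf, (Sum.inr i, Sum.inr j) ∈ E →
      g (Sum.inr j) (Sum.inr i) = -g (Sum.inr i) (Sum.inr j))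
    (x y : Fin nf → Vec d) :
    ∑ i, inner ℝ (laplacianFFLin E g x i) (y i) =
      ∑ i, ∑ j, (if (Sum.inr i, Sum.inl j) ∈ E then
        inner ℝ (bearingProjLin (g (Sum.inr i) (Sum.inl j)) (x i)) (y i) else 0) +
      (∑ i, ∑ j, (if (Sum.inr i, Sum.inr j) ∈ E then
        inner ℝ (bearingProjLin (g (Sum.inr i) (Sum.inr j)) (x i - x j)) (y i - y j) else 0)) / 2 := by
  set T := ∑ i, ∑ j, (if (Sum.inr i, Sum.inr j) ∈ E then
        inner ℝ (bearingProjLin (g (Sum.inr i) (Sum.inr j)) (x i - x j)) (y i) else 0) with hT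
  have h1 : ∑ i, inner ℝ (laplacianFFLin E g x i) (y i) =
      ∑ i, ∑ j, (if (Sum.inr i, Sum.inl j) ∈ E then
        inner ℝ (bearingProjLin (g (Sum.inr i) (Sum.inl j)) (x i)) (y i) else 0) + T := by
    rw [hT, ← Finset.sum_add_distrib]
    refine Finset.sum_congr rfl fun i _ => ?_
    simp only [laplacianFFLin, LinearMap.comp_apply, followerLaplacian_apply, sum_inner]
    simp only [nbrs, Finset.sum_filter, Fintype.sum_sum_type, extendFollowers_inl, extendFollowers_inr, sub_zero]
  -- Exchanging the endpoints of each follower edge reverses its bearing, which leaves the projector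
  -- unchanged, and reverses `x i - x j`. Averaging the two forms of `T` symmetrizes it.
  have h2 : T = ∑ i, ∑ j, (if (Sum.inr i, Sum.inr j) ∈ E then
        -inner ℝ (bearingProjLin (g (Sum.inr i) (Sum.inr j)) (x i - x j)) (y j) else 0) := by
    rw [hT, Finset.sum_comm]
    refine Finset.sum_congr rfl fun i _ => Finset.sum_congr rfl fun j _ => ?_
    by_cases h : (Sum.inr i, Sum.inr j) ∈ E
    · rw [if_pos h, if_pos (hE i j h), hg i j h, bearingProjLin_neg, ← neg_sub (x i) (x j),
        map_neg, inner_neg_left]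
    · rw [if_neg h, if_neg fun h' => h (hE j i h')]
  have h3 : ∑ i, ∑ j, (if (Sum.inr i, Sum.inr j) ∈ E then
        inner ℝ (bearingProjLin (g (Sum.inr i) (Sum.inr j)) (x i - x j)) (y i - y j) else 0) =
      T + T := by
    conv_rhs => rw [hT]; arg 2; rw [← hT, h2]
    rw [← Finset.sum_add_distrib]
    refine Finset.sum_congr rfl fun i _ => ?_
    rw [← Finset.sum_add_distrib]
    refine Finset.sum_congr rfl fun j _ => ?_
    split_ifs
    · rw [inner_sub_right]; ring
    · ring
  rw [h1, h3]
  ring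

theorem sum_inner_laplacianFFLin_symm {E : Finset (Agent nl nf × Agent nl nf)}
    (hE : FollowersBidirectional E) {g : Agent nl nf → Agent nl nf → Vec d}
    (hg : ∀ i j : Fin nf, (Sum.inr i, Sum.inr j) ∈ E →
      g (Sum.inr j) (Sum.inr i) = -g (Sum.inr i) (Sum.inr j))
    (x y : Fin nf → Vec d) :
    ∑ i, inner ℝ (laplacianFFLin E g x i) (y i) =
      ∑ i, inner ℝ (laplacianFFLin E g y i) (x i) := by
  rw [sum_inner_laplacianFFLin hE hg, sum_inner_laplacianFFLin hE hg]
  simp only [inner_bearingProjLin_symm _ (x _) (y _),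
    inner_bearingProjLin_symm _ (x _ - x _) (y _ - y _)]

/-- Edge-wise the form is a sum of squares `‖P_g z‖ ^ 2`. If it vanishes, so does every term, hence
every summand of the Laplacian at `x`, and injectivity gives `x = 0`. -/
theorem sum_inner_laplacianFFLin_self_pos {E : Finset (Agent nl nf × Agent nl nf)}
    (hE : FollowersBidirectional E) {g : Agent nl nf → Agent nl nf → Vec d}
    (hg : ∀ i j : Fin nf, (Sum.inr i, Sum.inr j) ∈ E →
      g (Sum.inr j) (Sum.inr i) = -g (Sum.inr i) (Sum.inr j))
    (hunit : ∀ i j, (i, j) ∈ E → ‖g i j‖ = 1)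
    (hinj : Function.Injective (laplacianFFLin E g)) {x : Fin nf → Vec d} (hx : x ≠ 0) :
    0 < ∑ i, inner ℝ (laplacianFFLin E g x i) (x i) := by
  rw [sum_inner_laplacianFFLin hE hg]
  have hterm : ∀ (i j : Agent nl nf) (z : Vec d),
      0 ≤ (if (i, j) ∈ E then inner ℝ (bearingProjLin (g i j) z) z else 0) := by
    intro i j z
    split_ifs with h
    · rw [inner_bearingProjLin_self (hunit i j h)]; positivity
    · exact le_rfl
  have hzero : ∀ (i j : Agent nl nf) (z : Vec d), (i, j) ∈ E →
      (if (i, j) ∈ E then inner ℝ (bearingProjLin (g i j) z) z else 0) = 0 →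
        bearingProjLin (g i j) z = 0 := by
    intro i j z h h0
    rw [if_pos h, inner_bearingProjLin_self (hunit i j h)] at h0
    exact norm_eq_zero.1 (pow_eq_zero_iff two_ne_zero |>.1 h0)
  have hl := Finset.sum_nonneg fun i (_ : i ∈ Finset.univ) => Finset.sum_nonneg
    fun j (_ : j ∈ Finset.univ) => hterm (Sum.inr i) (Sum.inl j) (x i)
  have hf := Finset.sum_nonneg fun i (_ : i ∈ Finset.univ) => Finset.sum_nonneg
    fun j (_ : j ∈ Finset.univ) => hterm (Sum.inr i) (Sum.inr j) (x i - x j)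
  refine lt_of_le_of_ne (by positivity) fun h => hx ?_
  have hl0 := le_antisymm (by linarith) hl
  have hf0 := le_antisymm (by linarith) hf
  apply hinj
  rw [map_zero]
  funext i
  simp only [laplacianFFLin, LinearMap.comp_apply, followerLaplacian_apply]
  refine Finset.sum_eq_zero fun j hj => ?_
  have hj : (Sum.inr i, j) ∈ E := by simpa [nbrs] using hj
  rcases j with j | j
  · rw [Finset.sum_eq_zero_iff_of_nonneg fun i _ => Finset.sum_nonneg fun j _ => hterm _ _ _] at hl0
    have h1 := hl0 i (Finset.mem_univ i)
    rw [Finset.sum_eq_zero_iff_of_nonneg fun j _ => hterm _ _ _] at h1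
    simpa using hzero _ _ _ hj (h1 j (Finset.mem_univ j))
  · rw [Finset.sum_eq_zero_iff_of_nonneg fun i _ => Finset.sum_nonneg fun j _ => hterm _ _ _] at hf0
    have h1 := hf0 i (Finset.mem_univ i)
    rw [Finset.sum_eq_zero_iff_of_nonneg fun j _ => hterm _ _ _] at h1
    exact hzero _ _ _ hj (h1 j (Finset.mem_univ j))

/-! ### Convergence and stability of the error system -/

/-- A positive quadratic form on a finite-dimensional space is coercive. -/
theorem exists_mul_norm_sq_le_inner {H : Type*} [NormedAddCommGroup H] [InnerProductSpace ℝ H]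
    [FiniteDimensional ℝ H] (A : H →L[ℝ] H) (hA : ∀ x, x ≠ 0 → 0 < inner ℝ (A x) x) :
    ∃ μ > 0, ∀ x, μ * ‖x‖ ^ 2 ≤ inner ℝ (A x) x := by
  rcases subsingleton_or_nontrivial H with hs | hn
  · exact ⟨1, one_pos, fun x => by simp [Subsingleton.elim x 0]⟩
  · have hc : Continuous fun x => (inner ℝ (A x) x : ℝ) := A.continuous.inner continuous_id
    obtain ⟨z, hz, hmin⟩ := (isCompact_sphere (0 : H) 1).exists_isMinOn
      (NormedSpace.sphere_nonempty.2 zero_le_one) hc.continuousOn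
    have hz0 : z ≠ 0 := by
      rintro rfl
      simp at hz
    refine ⟨inner ℝ (A z) z, hA z hz0, fun x => ?_⟩
    by_cases hx : x = 0
    · simp [hx]
    have hx' : ‖x‖ ≠ 0 := norm_ne_zero_iff.2 hx
    have h1 : ‖x‖⁻¹ • x ∈ Metric.sphere (0 : H) 1 := by
      simp [norm_smul, hx']
    have h2 := hmin h1
    simp only [mem_ofPred_eq, map_smul, real_inner_smul_left, real_inner_smul_right] at h2
    calc inner ℝ (A z) z * ‖x‖ ^ 2
        ≤ (‖x‖⁻¹ * (‖x‖⁻¹ * inner ℝ (A x) x)) * ‖x‖ ^ 2 := by gcongr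
      _ = inner ℝ (A x) x := by field_simp

/-- Identification of follower configurations with vectors in `ℝ^(nf d)`. -/
def flattenEquiv (nf d : ℕ) : (Fin nf → Vec d) ≃L[ℝ] EuclideanSpace ℝ (Fin nf × Fin d) :=
  LinearEquiv.toContinuousLinearEquiv
    { toFun := fun x => WithLp.toLp 2 fun y => x y.1 y.2
      invFun := fun z i => WithLp.toLp 2 fun a => z (i, a)
      map_add' := fun _ _ => rfl
      map_smul' := fun _ _ => rfl
      left_inv := fun _ => rfl
      right_inv := fun _ => rfl }

theorem flattenEquiv_apply (x : Fin nf → Vec d) (y : Fin nf × Fin d) :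
    flattenEquiv nf d x y = x y.1 y.2 := rfl

theorem inner_flattenEquiv (x y : Fin nf → Vec d) :
    inner ℝ (flattenEquiv nf d x) (flattenEquiv nf d y) = ∑ i, (inner ℝ (x i) (y i) : ℝ) := by
  simp [PiLp.inner_apply, flattenEquiv_apply, Fintype.sum_prod_type]

/-- Convergence and Lyapunov stability of `δ' = η`, `η' = -S(B (kp δ + kv η))`, where `S` is a
component-wise saturation and `B` is symmetric positive definite. -/
theorem tendsto_and_stable_of_saturated {sat : ℝ → ℝ} {m K : ℝ} (hsat : IsSectorFunction m K sat)
    (hm : 0 < m) (hK : 0 < K) (B : (Fin nf → Vec d) ≃L[ℝ] (Fin nf → Vec d))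
    (hBsymm : ∀ x y, ∑ i, inner ℝ (B x i) (y i) = ∑ i, (inner ℝ (B y i) (x i) : ℝ))
    (hBpos : ∀ x, x ≠ 0 → 0 < ∑ i, (inner ℝ (B x i) (x i) : ℝ))
    {kp kv : ℝ} (hkp : 0 < kp) (hkv : 0 < kv) (P : (ℝ → Fin nf → Vec d) → (ℝ → Fin nf → Vec d) → Prop)
    (hP : ∀ δ η, P δ η → (∀ t, 0 ≤ t → HasDerivWithinAt δ (η t) (Ici 0) t) ∧
      ∀ t, 0 ≤ t → HasDerivWithinAt η
        (fun i => satVec sat (-(B (kp • δ t + kv • η t) i))) (Ici 0) t) :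
    (∀ δ η, P δ η → Tendsto δ atTop (𝓝 0) ∧ Tendsto η atTop (𝓝 0)) ∧
    (∀ ε > 0, ∃ r > 0, ∀ δ η, P δ η → ‖δ 0‖ < r → ‖η 0‖ < r →
      ∀ t, 0 ≤ t → ‖δ t‖ < ε ∧ ‖η t‖ < ε) := by
  -- Configurations carry the sup norm over agents; flattening supplies the inner product needed by
  -- the Lyapunov argument.
  set e := flattenEquiv nf d with he
  set S : EuclideanSpace ℝ (Fin nf × Fin d) → EuclideanSpace ℝ (Fin nf × Fin d) :=
    fun y => WithLp.toLp 2 fun i => sat (y i) with hSdef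
  have hS := hsat.isSectorGradient (ι := Fin nf × Fin d) hm hK
  set A : EuclideanSpace ℝ (Fin nf × Fin d) →L[ℝ] EuclideanSpace ℝ (Fin nf × Fin d) :=
    ((e.symm.trans B).trans e).toContinuousLinearMap with hAdef
  have hAe : ∀ x, A (e x) = e (B x) := fun x => by simp [A]
  have hAsymm : ∀ x y, inner ℝ (A x) y = inner ℝ x (A y) := by
    intro x y
    obtain ⟨x, rfl⟩ := e.surjective x
    obtain ⟨y, rfl⟩ := e.surjective y
    rw [real_inner_comm (A (e y)) (e x), hAe, hAe, inner_flattenEquiv, inner_flattenEquiv, hBsymm]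
  have hApos : ∀ x, x ≠ 0 → 0 < inner ℝ (A x) x := by
    intro x hx
    obtain ⟨x, rfl⟩ := e.surjective x
    rw [hAe, inner_flattenEquiv]
    exact hBpos x fun h => hx (by rw [h, map_zero])
  obtain ⟨μ, hμ, hAμ⟩ := exists_mul_norm_sq_le_inner A hApos
  have hSe : ∀ x : Fin nf → Vec d, e (fun i => satVec sat (-(x i))) = -S (e x) := by
    intro x
    ext y
    simp [he, flattenEquiv_apply, satVec, hSdef, hsat.odd]
  -- passing from errors to the coordinates of the Lyapunov function and back
  set Y : (Fin nf → Vec d) × (Fin nf → Vec d) → EuclideanSpace ℝ (Fin nf × Fin d) :=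
    fun z => e (B (kp • z.1 + kv • z.2)) with hY
  have hdecay : ∀ C₀ : ℝ, ∃ M > 0, ∃ l > 0, ∀ δ η, P δ η →
      ‖Y (δ 0, η 0)‖ ^ 2 + ‖e (η 0)‖ ^ 2 ≤ C₀ → ∀ t, 0 ≤ t →
        ‖Y (δ t, η t)‖ ^ 2 + ‖e (η t)‖ ^ 2 ≤
          M * (‖Y (δ 0, η 0)‖ ^ 2 + ‖e (η 0)‖ ^ 2) * Real.exp (-l * t) := by
    intro C₀
    obtain ⟨M, hM, l, hl, h⟩ :=
      exponential_decay_of_isSectorGradient hS hAsymm hμ hAμ hkp hkv C₀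
    refine ⟨M, hM, l, hl, fun δ η hδη h0 t ht =>
      h (fun t => Y (δ t, η t)) (fun t => e (η t)) (fun t ht => ?_) (fun t ht => ?_) h0 t ht⟩
    · obtain ⟨h1, h2⟩ := hP δ η hδη
      have h3 := ((h1 t ht).const_smul kp).add ((h2 t ht).const_smul kv)
      have h4 := (B.trans e).toContinuousLinearMap.hasFDerivAt.comp_hasDerivWithinAt t h3
      refine h4.congr_deriv ?_
      change e (B _) = _
      rw [map_add, map_smul, map_smul, map_add, map_smul, map_smul, ← hAe, ← hAe, hSe, map_neg,
        smul_neg, ← sub_eq_add_neg]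
    · obtain ⟨h1, h2⟩ := hP δ η hδη
      have h4 := e.toContinuousLinearMap.hasFDerivAt.comp_hasDerivWithinAt t (h2 t ht)
      refine h4.congr_deriv ?_
      exact hSe _
  have hYc : Continuous Y := by fun_prop
  -- A continuous left inverse of the change of variables, so that smallness of `(y, η)` yields
  -- smallness of `(δ, η)`.
  set Z : EuclideanSpace ℝ (Fin nf × Fin d) × EuclideanSpace ℝ (Fin nf × Fin d) →
      (Fin nf → Vec d) × (Fin nf → Vec d) :=
    fun z => (kp⁻¹ • (B.symm (e.symm z.1) - kv • e.symm z.2), e.symm z.2) with hZ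
  have hZc : Continuous Z := by fun_prop
  have hZ0 : Z 0 = 0 := by simp [hZ]
  have hZY : ∀ δ η, Z (Y (δ, η), e η) = (δ, η) := by
    intro δ η
    simp [hZ, hY, smul_smul, hkp.ne']
  have hN : Continuous fun z : (Fin nf → Vec d) × (Fin nf → Vec d) =>
      ‖Y z‖ ^ 2 + ‖e z.2‖ ^ 2 := by fun_prop
  have hN0 : ‖Y 0‖ ^ 2 + ‖e (0 : (Fin nf → Vec d) × (Fin nf → Vec d)).2‖ ^ 2 = 0 := by simp [hY]
  have hsmall : ∀ ε > 0, ∃ r > 0, ∀ δ η, ‖Y (δ, η)‖ ^ 2 + ‖e η‖ ^ 2 < r →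
      ‖δ‖ < ε ∧ ‖η‖ < ε := by
    intro ε hε
    obtain ⟨r, hr, h⟩ := Metric.continuousAt_iff.1 (hZc.continuousAt (x := 0)) ε hε
    refine ⟨r ^ 2, by positivity, fun δ η hδη => ?_⟩
    have h1 : ‖Y (δ, η)‖ < r := lt_of_pow_lt_pow_left₀ 2 hr.le
      (lt_of_le_of_lt (by nlinarith [sq_nonneg ‖e η‖]) hδη)
    have h2 : ‖e η‖ < r := lt_of_pow_lt_pow_left₀ 2 hr.le
      (lt_of_le_of_lt (by nlinarith [sq_nonneg ‖Y (δ, η)‖]) hδη)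
    have h3 := @h (Y (δ, η), e η) (by rw [dist_zero_right]; exact max_lt h1 h2)
    rw [hZ0, dist_zero_right, hZY] at h3
    exact max_lt_iff.1 h3
  constructor
  · intro δ η hδη
    -- The decay constants may depend on the trajectory here, which makes the attraction global;
    -- stability below needs them uniform, on the fixed bound `1`.
    obtain ⟨M, hM, l, hl, h⟩ := hdecay (‖Y (δ 0, η 0)‖ ^ 2 + ‖e (η 0)‖ ^ 2)
    have h1 := h δ η hδη le_rfl
    have hexp : Tendsto (fun t => M * (‖Y (δ 0, η 0)‖ ^ 2 + ‖e (η 0)‖ ^ 2) * Real.exp (-l * t))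
        atTop (𝓝 0) := by
      have h2 : Tendsto (fun t => -l * t) atTop atBot :=
        tendsto_id.const_mul_atTop_of_neg (by linarith)
      simpa using (Real.tendsto_exp_atBot.comp h2).const_mul
        (M * (‖Y (δ 0, η 0)‖ ^ 2 + ‖e (η 0)‖ ^ 2))
    have hev : ∀ ε > 0, ∀ᶠ t in atTop, ‖δ t‖ < ε ∧ ‖η t‖ < ε := by
      intro ε hε
      obtain ⟨r, hr, hr'⟩ := hsmall ε hε
      filter_upwards [hexp.eventually_lt_const hr, eventually_ge_atTop 0] with t ht ht0
      exact hr' _ _ ((h1 t ht0).trans_lt ht)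
    simp only [NormedAddGroup.tendsto_nhds_zero]
    exact ⟨fun ε hε => (hev ε hε).mono fun t ht => ht.1,
      fun ε hε => (hev ε hε).mono fun t ht => ht.2⟩
  · intro ε hε
    obtain ⟨M, hM, l, hl, h⟩ := hdecay 1
    obtain ⟨r, hr, hr'⟩ := hsmall ε hε
    obtain ⟨s, hs, hs'⟩ := Metric.continuousAt_iff.1 (hN.continuousAt (x := 0)) (min 1 (r / M))
      (lt_min one_pos (by positivity))
    refine ⟨s, hs, fun δ η hδη hδ hη t ht => hr' _ _ ?_⟩
    have h1 := @hs' (δ 0, η 0) (by rw [dist_zero_right]; exact max_lt hδ hη)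
    rw [hN0, dist_zero_right, Real.norm_of_nonneg (by positivity)] at h1
    obtain ⟨h2, h3⟩ := lt_min_iff.1 h1
    refine (h δ η hδη h2.le t ht).trans_lt ?_
    rw [lt_div_iff₀' hM] at h3
    refine lt_of_le_of_lt (mul_le_of_le_one_right (by positivity) ?_) h3
    exact Real.exp_le_one_iff.2 (by nlinarith)

/-! ### Closed loop and target formation -/

theorem followerLaplacian_eq_add (E : Finset (Agent nl nf × Agent nl nf))
    (g : Agent nl nf → Agent nl nf → Vec d) (z : Agent nl nf → Vec d) :
    followerLaplacian E g z = followerLaplacian E g (extendLeaders fun i => z (Sum.inl i)) +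
      laplacianFFLin E g fun i => z (Sum.inr i) := by
  conv_lhs => rw [← extendLeaders_add_extendFollowers z, map_add]
  rfl

/-- By linearity position and velocity feedback merge into one Laplacian of `kp • p + kv • v`, which
becomes the Lyapunov variable `y`. -/
theorem saturatedControl_eq (E : Finset (Agent nl nf × Agent nl nf))
    (g : Agent nl nf → Agent nl nf → Vec d) (sat : ℝ → ℝ) (kp kv : ℝ)
    (p v : Agent nl nf → Vec d) (i : Fin nf) :
    saturatedControl E g sat kp kv p v (Sum.inr i) =
      satVec sat (-(followerLaplacian E g (kp • p + kv • v) i)) := by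
  rw [saturatedControl, followerLaplacian_apply]
  congr 2
  refine Finset.sum_congr rfl fun j _ => ?_
  rw [toLp_bearingProj_mulVec]
  congr 1
  simp only [Pi.add_apply, Pi.smul_apply, smul_sub]
  abel

namespace IsTargetFormation

variable {E : Finset (Agent nl nf × Agent nl nf)} {g : Agent nl nf → Agent nl nf → Vec d}
  {pl : ℝ → Fin nl → Vec d} {ps : ℝ → Agent nl nf → Vec d}

theorem not_mem_self (h : IsTargetFormation E g pl ps) (i : Agent nl nf) : (i, i) ∉ E :=
  fun hi => h.ne 0 le_rfl i i hi rfl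

theorem norm_eq_one (h : IsTargetFormation E g pl ps) (i j : Agent nl nf) (hij : (i, j) ∈ E) :
    ‖g i j‖ = 1 := by
  rw [← h.bearing_eq 0 le_rfl i j hij]
  exact norm_bearing (h.ne 0 le_rfl i j hij)

theorem swap (h : IsTargetFormation E g pl ps) {i j : Agent nl nf} (hij : (i, j) ∈ E)
    (hji : (j, i) ∈ E) : g j i = -g i j := by
  rw [← h.bearing_eq 0 le_rfl i j hij, ← h.bearing_eq 0 le_rfl j i hji, bearing_swap]

theorem followerLaplacian_eq_zero (h : IsTargetFormation E g pl ps) {t : ℝ} (ht : 0 ≤ t) :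
    followerLaplacian E g (ps t) = 0 := by
  funext i
  rw [followerLaplacian_apply]
  refine Finset.sum_eq_zero fun j hj => ?_
  have hj : (Sum.inr i, j) ∈ E := by simpa [nbrs] using hj
  rw [← h.bearing_eq t ht _ _ hj]
  exact bearingProjLin_bearing_sub (h.ne t ht _ _ hj)

end IsTargetFormation

end

theorem theorem7 {d nl nf : ℕ}
    (E : Finset (Agent nl nf × Agent nl nf)) (hE : FollowersBidirectional E)
    (g : Agent nl nf → Agent nl nf → Vec d)
    (pl vl : ℝ → Fin nl → Vec d)
    (hpl : ∀ t, 0 ≤ t → ∀ i, HasDerivWithinAt (fun s => pl s i) (vl t i) (Ici 0) t)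
    (hvl : ∀ t, 0 ≤ t → vl t = vl 0)
    (ps : ℝ → Agent nl nf → Vec d) (hps : IsTargetFormation E g pl ps)
    (hL : (laplacianFF E g).det ≠ 0)
    (kp kv β : ℝ) (hkp : 0 < kp) (hkv : 0 < kv) (hβ : 0 < β)
    (sat : ℝ → ℝ) (hsat : IsSaturation β sat) :
    -- the velocity of the followers in the target formation exists
    (∀ i : Fin nf, DifferentiableOn ℝ (fun t => ps t (Sum.inr i)) (Ici 0)) ∧
    -- every trajectory of the closed loop converges to the target formation
    (∀ p v : ℝ → Agent nl nf → Vec d,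
      IsClosedLoopTrajectory E g sat kp kv pl vl p v →
        Tendsto (posError p ps) atTop (𝓝 0) ∧ Tendsto (velError v ps) atTop (𝓝 0)) ∧
    -- zero tracking error is stable in the sense of Lyapunov
    (∀ ε > 0, ∃ η > 0, ∀ p v : ℝ → Agent nl nf → Vec d,
      IsClosedLoopTrajectory E g sat kp kv pl vl p v →
        ‖posError p ps 0‖ < η → ‖velError v ps 0‖ < η →
          ∀ t, 0 ≤ t → ‖posError p ps t‖ < ε ∧ ‖velError v ps t‖ < ε) := by
  have hloop := hps.not_mem_self
  have hinj := laplacianFFLin_injective hloop hL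
  have hswap : ∀ i j : Fin nf, (Sum.inr i, Sum.inr j) ∈ E →
      g (Sum.inr j) (Sum.inr i) = -g (Sum.inr i) (Sum.inr j) :=
    fun i j hij => hps.swap hij (hE i j hij)
  let B : (Fin nf → Vec d) ≃L[ℝ] (Fin nf → Vec d) :=
    (LinearEquiv.ofInjectiveEndo (laplacianFFLin E g) hinj).toContinuousLinearEquiv
  have hB : ∀ x, B x = laplacianFFLin E g x := fun x => rfl
  let G : (Fin nl → Vec d) →L[ℝ] (Fin nf → Vec d) := LinearMap.toContinuousLinearMap
    (-(B.symm.toLinearEquiv.toLinearMap ∘ₗ followerLaplacian E g ∘ₗ extendLeaders))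
  have hG : ∀ w, G w = -B.symm (followerLaplacian E g (extendLeaders w)) := fun w => rfl
  have hBG : ∀ w, B (G w) = -followerLaplacian E g (extendLeaders w) := fun w => by
    rw [hG, map_neg, B.apply_symm_apply]
  -- The follower rows vanish on the target, and invertibility of `B` solves them for the followers.
  have hpsG : ∀ t, 0 ≤ t → (fun i => ps t (Sum.inr i)) = G (pl t) := by
    intro t ht
    have h1 := hps.followerLaplacian_eq_zero ht
    rw [followerLaplacian_eq_add, funext (hps.leader t ht)] at h1
    apply B.injective
    rw [hBG, hB]
    exact eq_neg_of_add_eq_zero_right h1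
  have hpsd : ∀ t, 0 ≤ t →
      HasDerivWithinAt (fun s i => ps s (Sum.inr i)) (G (vl 0)) (Ici 0) t := by
    intro t ht
    have h1 : HasDerivWithinAt pl (vl 0) (Ici 0) t :=
      hasDerivWithinAt_pi.2 fun i => hvl t ht ▸ hpl t ht i
    exact (G.hasFDerivAt.comp_hasDerivWithinAt t h1).congr (fun s hs => hpsG s hs) (hpsG t ht)
  have hpsdi : ∀ t, 0 ≤ t → ∀ i,
      HasDerivWithinAt (fun s => ps s (Sum.inr i)) (G (vl 0) i) (Ici 0) t :=
    fun t ht => hasDerivWithinAt_pi.1 (hpsd t ht)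
  have hvel : ∀ (v : ℝ → Agent nl nf → Vec d) t, 0 ≤ t →
      velError v ps t = (fun i => v t (Sum.inr i)) - G (vl 0) := by
    intro v t ht
    funext i
    simp only [velError, Pi.sub_apply]
    rw [(hpsdi t ht i).derivWithin (uniqueDiffOn_Ici 0 t ht)]
  obtain ⟨m, hm, K, hK, hsector⟩ := hsat.isSectorFunction hβ
  have hmain := tendsto_and_stable_of_saturated hsector hm hK B
    (sum_inner_laplacianFFLin_symm hE hswap)
    (fun x hx => sum_inner_laplacianFFLin_self_pos hE hswap hps.norm_eq_one hinj hx) hkp hkv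
    (fun δ η => ∃ p v, IsClosedLoopTrajectory E g sat kp kv pl vl p v ∧
      δ = posError p ps ∧ η = velError v ps) (by
    rintro _ _ ⟨p, v, h, rfl, rfl⟩
    refine ⟨fun t ht => ?_, fun t ht => ?_⟩
    · rw [hvel v t ht]
      exact hasDerivWithinAt_pi.2 fun i => (h.follower_pos t ht i).sub (hpsdi t ht i)
    -- The true and target formations share their leaders, so the leader part cancels and only the
    -- follower error is left.
    · have hp : followerLaplacian E g (p t) = B (posError p ps t) := by
        have h1 := hps.followerLaplacian_eq_zero ht
        rw [followerLaplacian_eq_add, funext (hps.leader t ht)] at h1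
        rw [followerLaplacian_eq_add, funext (h.leader_pos t ht), eq_neg_of_add_eq_zero_left h1,
          hB, neg_add_eq_sub, ← map_sub]
        rfl
      -- The leader part is `-B (G (vl 0))`, which is exactly the subtraction of the target
      -- velocity.
      have hv : followerLaplacian E g (v t) = B (velError v ps t) := by
        rw [followerLaplacian_eq_add, funext (h.leader_vel t ht), hvl t ht, hvel v t ht, map_sub,
          hBG, sub_neg_eq_add, add_comm, hB]
      have hd : HasDerivWithinAt (fun s => (fun i => v s (Sum.inr i)) - G (vl 0))
          (fun i => saturatedControl E g sat kp kv (p t) (v t) (Sum.inr i)) (Ici 0) t :=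
        (hasDerivWithinAt_pi.2 fun i => h.follower_vel t ht i).sub_const _
      refine (hd.congr (fun s hs => hvel v s hs) (hvel v t ht)).congr_deriv ?_
      funext i
      rw [saturatedControl_eq, map_add, map_smul, map_smul, hp, hv, map_add, map_smul, map_smul])
  refine ⟨fun i t ht => (hpsdi t ht i).differentiableWithinAt, fun p v h =>
    hmain.1 _ _ ⟨p, v, h, rfl, rfl⟩, fun ε hε => ?_⟩
  obtain ⟨r, hr, hr'⟩ := hmain.2 ε hε
  exact ⟨r, hr, fun p v h => hr' _ _ ⟨p, v, h, rfl, rfl⟩⟩
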